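/- Work over $\mathbb C$, and write $\mathbb N=\{1,2,\dots\}$, $\mathbb Z^*=\mathbb Z\setminus\{0\}$. Let $V$ be the superspace with even basis $\{e_j : j\in\mathbb Z^*\}$ and odd basis $\{e_r : r\in\frac12+\mathbb Z\}$, with the skew-supersymmetric bilinear form $(e_i|e_j)=\operatorname{sgn}(i)\,\delta_{i,-j}$ for $i,j\in\mathbb Z^*$, $(e_r|e_s)=\delta_{r,-s}$ for $r,s\in\frac12+\mathbb Z$, and $(e_i|e_r)=(e_r|e_i)=0$. Let $\mathcal A$ be the Lie superalgebra of matrices $A=(a_{ij})$, with $i,j$ running over the nonzero half-integers $\frac12\mathbb Z\setminus\{0\}$, such that $a_{ij}=0$ whenever $|i-j|$ is sufficiently large (depending on $A$). It is $\frac12\mathbb Z$-graded, the matrix unit $e_{ij}$ having degree $j-i$; the parity $|A|$ of a homogeneous $A$ is $2\deg A \bmod 2$, and $[A,B]=AB-(-1)^{|A||B|}BA$. Let $\mathcal C=\mathcal C_0\oplus\mathcal C_1\subset\mathcal A$ be the subalgebra preserving the form, that is, $\mathcal C_\epsilon$ consists of the $A\in\mathcal A$ of parity $\epsilon$ with $(Av|w)=-(-1)^{\epsilon|v|}(v|Aw)$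 for all homogeneous $v\in V$ and all $w\in V$. Let $\hat{\mathcal C}=\mathcal C\oplus\mathbb C C$ be the central extension of $\mathcal C$ by an even central element $C$ with the two-cocycle $\alpha(A,B)=\operatorname{Str}([J,A]B)$, where $J=\sum_{r\le 0}e_{rr}$ and $\operatorname{Str}(D)=\sum_r(-1)^{2r}d_{rr}$. With $\deg C=0$ it is $\frac12\mathbb Z$-graded, $\hat{\mathcal C}=\bigoplus_p\hat{\mathcal C}_p$; put $\hat{\mathcal C}_\pm=\bigoplus_{p>0}\hat{\mathcal C}_{\pm p}$. The degree-zero part $\hat{\mathcal C}_0$ is abelian; it consists of the elements $\sum_{r\in\frac12\mathbb N}a_r\tilde e_{rr}+dC$ with $\tilde e_{rr}=e_{rr}-e_{-r,-r}$ and arbitrary $a_r,d\in\mathbb C$. For $s\in\frac12\mathbb N$ define $\omega_s,\Lambda_0\in(\hat{\mathcal C}_0)^*$ by $\omega_s\bigl(\sum_r a_r\tilde e_{rr}+dC\bigr)=a_s$ and $\Lambda_0\bigl(\sum_r a_r\tilde e_{rr}+dC\bigr)=d$. A highest weight $\hat{\mathcal C}$-module with highest weight $\xi\in(\hat{\mathcal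 C}_0)^*$ and highest weight vector $v_\xi\neq0$ is a $\hat{\mathcal C}$-module $M$ such that $hv_\xi=\xi(h)v_\xi$ for all $h\in\hat{\mathcal C}_0$, $\hat{\mathcal C}_+v_\xi=0$ and $\mathcal U(\hat{\mathcal C}_-)v_\xi=M$. It is $\frac12\mathbb Z$-graded, $M=\bigoplus_jM_j$ with $M_j=\mathcal U(\hat{\mathcal C}_-)_j\,v_\xi$, so that $v_\xi$ has degree $0$; $M$ is called quasi-finite if $\dim M_j<\infty$ for all $j\in\frac12\mathbb Z$. Theorem. Let $M$ be an irreducible highest weight $\hat{\mathcal C}$-module with highest weight $\xi$ and highest weight vector $v_\xi\ne 0$. The following are equivalent: (i) $M$ is quasi-finite; (ii) $\hat{\mathcal C}_{-1/2}\,v_\xi$ is finite dimensional; (iii) there exist $N\in\mathbb N$ and complex numbers $d$ and $\xi_j$ ($j\in\frac12\mathbb N$, $j\le N$) such that $\xi=\sum_{j\in\frac12\mathbb N,\ j\le N}\xi_j\omega_j+d\Lambda_0$. -/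

import Mathlib

namespace InfSPO

/-!
Conventions. The index set `½ℤ` is encoded by `ℤ` through doubling: the integer `i` stands for
the half-integer `i / 2`. So even integers index the even basis vectors, odd integers index the odd
ones, a degree `p ∈ ½ℤ` is encoded by the integer `2p`, and the sign `(-1)^{4 deg A deg B}`
becomes `(-1)^(p * q)` for the encoded degrees `p`, `q`.
-/

/-- The sign `(-1)^n`. -/
noncomputable def sgn (n : ℤ) : ℂ := (-1 : ℂ) ^ n

/-- `gl_{∞|∞}`: the matrices `(a_{ij})` indexed by `½ℤ` with `a_{ij} = 0` for `|j - i| ≫ 0`. -/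
def gl : Submodule ℂ (Matrix ℤ ℤ ℂ) where
  carrier := {A | ∃ b : ℤ, ∀ i j, b < |j - i| → A i j = 0}
  zero_mem' := ⟨0, fun _ _ _ => rfl⟩
  add_mem' := by
    rintro A B ⟨a, ha⟩ ⟨b, hb⟩
    refine ⟨max a b, fun i j h => ?_⟩
    rw [Matrix.add_apply, ha i j (lt_of_le_of_lt (le_max_left _ _) h),
      hb i j (lt_of_le_of_lt (le_max_right _ _) h), add_zero]
  smul_mem' := by
    rintro c A ⟨a, ha⟩
    exact ⟨a, fun i j h => by rw [Matrix.smul_apply, ha i j h, smul_zero]⟩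

/-- The product of two matrices. For elements of `gl` all the sums are finite. -/
noncomputable def mul (A B : Matrix ℤ ℤ ℂ) : Matrix ℤ ℤ ℂ :=
  fun i k => ∑ᶠ j, A i j * B j k

/-- The super-bracket, which is `A B - (-1)^{|A| |B|} B A` for homogeneous `A`, `B`, extended
bilinearly: the matrix unit `e_{ij}` has degree `j - i`, so that the summand `B_{ij} A_{jk}`
comes with the sign `(-1)^{(j - i)(k - j)}`. -/
noncomputable def bracket (A B : Matrix ℤ ℤ ℂ) : Matrix ℤ ℤ ℂ :=
  fun i k => ∑ᶠ j, (A i j * B j k - sgn ((j - i) * (k - j)) * (B i j * A j k))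

/-- The supertrace `∑_r (-1)^{2r} d_{rr}` (for the diagonals that occur, a finite sum). -/
noncomputable def str (D : Matrix ℤ ℤ ℂ) : ℂ := ∑ᶠ i, sgn i * D i i

/-- `J = ∑_{r ≤ 0} e_{rr}`. -/
def J : Matrix ℤ ℤ ℂ := Matrix.diagonal fun i => if i ≤ 0 then 1 else 0

/-- The two-cocycle `α(A, B) = Str([J, A] B)`. -/
noncomputable def cocycle (A B : Matrix ℤ ℤ ℂ) : ℂ := str (mul (bracket J A) B)

/-- The subalgebra `𝒜` of `gl_{∞|∞}`: `a_{ij} = 0` if `i = 0` or `j = 0`. -/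
def algA : Submodule ℂ (Matrix ℤ ℤ ℂ) where
  carrier := {A | A ∈ gl ∧ ∀ i j, (i = 0 ∨ j = 0) → A i j = 0}
  zero_mem' := ⟨gl.zero_mem, fun _ _ _ => rfl⟩
  add_mem' := by
    rintro A B ⟨hA, ha⟩ ⟨hB, hb⟩
    exact ⟨gl.add_mem hA hB, fun i j h => by rw [Matrix.add_apply, ha i j h, hb i j h, add_zero]⟩
  smul_mem' := by
    rintro c A ⟨hA, ha⟩
    exact ⟨gl.smul_mem c hA, fun i j h => by rw [Matrix.smul_apply, ha i j h, smul_zero]⟩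

/-- The value `(e_i | e_j)` of the skew-supersymmetric form on the superspace with even basis
`e_i`, `i ∈ ℤ \ {0}`, and odd basis `e_r`, `r ∈ ½ + ℤ`:
`(e_i | e_j) = sgn(i) δ_{i,-j}`, `(e_r | e_s) = δ_{r,-s}`, `(e_i | e_r) = (e_r | e_i) = 0`. -/
def form (i j : ℤ) : ℂ :=
  if i = -j then (if Even i then ((Int.sign i : ℤ) : ℂ) else 1) else 0

/-- The parity-`ε` part `𝒞_ε` (`ε = 0, 1`): the `A ∈ 𝒜` of parity `ε` such that
`(A v | w) = -(-1)^{ε |v|} (v | A w)`, written out on basis vectors `v = e_i`, `w = e_j`. -/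
noncomputable def algCPart (ε : ℤ) : Submodule ℂ (Matrix ℤ ℤ ℂ) where
  carrier := {A | A ∈ algA ∧ (∀ i j, ¬ (j - i) ≡ ε [ZMOD 2] → A i j = 0) ∧
    ∀ i j, ∑ᶠ k, A k i * form k j = -sgn (ε * i) * ∑ᶠ k, form i k * A k j}
  zero_mem' := ⟨algA.zero_mem, fun _ _ _ => rfl, fun i j => by simp⟩
  add_mem' := by
    rintro A B ⟨hA, ha, ha'⟩ ⟨hB, hb, hb'⟩
    refine ⟨algA.add_mem hA hB, fun i j h => by
      rw [Matrix.add_apply, ha i j h, hb i j h, add_zero], fun i j => ?_⟩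
    have e1 : ∀ A : Matrix ℤ ℤ ℂ, ∑ᶠ k, A k i * form k j = A (-j) i * form (-j) j := fun A =>
      finsum_eq_single _ _ fun k hk => by simp [form, hk]
    have e2 : ∀ A : Matrix ℤ ℤ ℂ, ∑ᶠ k, form i k * A k j = form i (-i) * A (-i) j := fun A =>
      finsum_eq_single _ _ fun k hk => by
        have : i ≠ -k := fun h => hk (by omega)
        simp [form, this]
    have h1 := ha' i j
    have h2 := hb' i j
    rw [e1, e2] at h1 h2 ⊢
    simp only [Matrix.add_apply]
    linear_combination h1 + h2
  smul_mem' := by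
    rintro c A ⟨hA, ha, ha'⟩
    refine ⟨algA.smul_mem c hA, fun i j h => by
      rw [Matrix.smul_apply, ha i j h, smul_zero], fun i j => ?_⟩
    have e1 : ∀ A : Matrix ℤ ℤ ℂ, ∑ᶠ k, A k i * form k j = A (-j) i * form (-j) j := fun A =>
      finsum_eq_single _ _ fun k hk => by simp [form, hk]
    have e2 : ∀ A : Matrix ℤ ℤ ℂ, ∑ᶠ k, form i k * A k j = form i (-i) * A (-i) j := fun A =>
      finsum_eq_single _ _ fun k hk => by
        have : i ≠ -k := fun h => hk (by omega)
        simp [form, this]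
    have h1 := ha' i j
    rw [e1, e2] at h1 ⊢
    simp only [Matrix.smul_apply, smul_eq_mul]
    linear_combination c * h1

/-- The Lie superalgebra `𝒞 = 𝒞_0 ⊕ 𝒞_1`. -/
noncomputable def algC : Submodule ℂ (Matrix ℤ ℤ ℂ) := algCPart 0 ⊔ algCPart 1

/-! ### Closure of `𝒞` under the super-bracket -/

theorem sgn_add (m n : ℤ) : sgn (m + n) = sgn m * sgn n :=
  zpow_add₀ (by norm_num) m n

theorem sgn_even {n : ℤ} (h : Even n) : sgn n = 1 := h.neg_one_zpow

theorem sgn_odd {n : ℤ} (h : Odd n) : sgn n = -1 := h.neg_one_zpow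

theorem sgn_congr {m n : ℤ} (h : m ≡ n [ZMOD 2]) : sgn m = sgn n := by
  rcases Int.even_or_odd m with hm | hm <;> rcases Int.even_or_odd n with hn | hn
  · rw [sgn_even hm, sgn_even hn]
  · rw [Int.even_iff] at hm; rw [Int.odd_iff] at hn; unfold Int.ModEq at h; omega
  · rw [Int.odd_iff] at hm; rw [Int.even_iff] at hn; unfold Int.ModEq at h; omega
  · rw [sgn_odd hm, sgn_odd hn]

/-- The form on basis vectors, as a function of the first index. -/
def gram (i : ℤ) : ℂ := if Even i then ((Int.sign i : ℤ) : ℂ) else 1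

theorem finsum_form_left (A : Matrix ℤ ℤ ℂ) (i j : ℤ) :
    ∑ᶠ k, A k i * form k j = A (-j) i * gram (-j) := by
  rw [finsum_eq_single _ (-j) fun k hk => by simp [form, hk]]
  simp [form, gram]

theorem finsum_form_right (A : Matrix ℤ ℤ ℂ) (i j : ℤ) :
    ∑ᶠ k, form i k * A k j = gram i * A (-i) j := by
  rw [finsum_eq_single _ (-i) fun k hk => by
    have : i ≠ -k := fun h => hk (by omega)
    simp [form, this]]
  simp [form, gram]

/-- Entrywise description of `𝒞`. -/
theorem mem_algC_iff (A : Matrix ℤ ℤ ℂ) :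
    A ∈ algC ↔ A ∈ algA ∧
      ∀ i j, A i j * gram i = -sgn ((i + j) * j) * (gram j * A (-j) (-i)) := by
  constructor
  · intro h
    obtain ⟨X, ⟨hX, pX, cX⟩, Y, ⟨hY, pY, cY⟩, rfl⟩ := Submodule.mem_sup.1 h
    refine ⟨algA.add_mem hX hY, fun i j => ?_⟩
    have h1 := cX j (-i)
    have h2 := cY j (-i)
    rw [finsum_form_left, finsum_form_right, neg_neg] at h1 h2
    simp only [Matrix.add_apply]
    by_cases hp : j - i ≡ 0 [ZMOD 2]
    · have z1 := pY i j (by unfold Int.ModEq at hp ⊢; omega)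
      have z2 := pY (-j) (-i) (by unfold Int.ModEq at hp ⊢; omega)
      have e : sgn ((i + j) * j) = sgn (0 * j) :=
        sgn_congr (Int.ModEq.mul_right _ (by unfold Int.ModEq at hp ⊢; omega))
      rw [z1, z2, e]
      linear_combination h1
    · have z1 := pX i j hp
      have z2 := pX (-j) (-i) (by unfold Int.ModEq at hp ⊢; omega)
      have e : sgn ((i + j) * j) = sgn (1 * j) :=
        sgn_congr (Int.ModEq.mul_right _ (by unfold Int.ModEq at hp ⊢; omega))
      rw [z1, z2, e]
      linear_combination h2
  · rintro ⟨⟨⟨b, hb⟩, hz⟩, hc⟩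
    have key : ∀ ε : ℤ, (Matrix.of fun i j => if j - i ≡ ε [ZMOD 2] then A i j else 0) ∈
        algCPart ε := by
      intro ε
      refine ⟨⟨⟨b, fun i j h => ?_⟩, fun i j h => ?_⟩, fun i j h => if_neg h, fun i j => ?_⟩
      · simp [hb i j h]
      · simp [hz i j h]
      · rw [finsum_form_left, finsum_form_right]
        by_cases hp : i - -j ≡ ε [ZMOD 2]
        · have hp' : j - -i ≡ ε [ZMOD 2] := by unfold Int.ModEq at hp ⊢; omega
          have e : sgn ((-j + i) * i) = sgn (ε * i) :=
            sgn_congr (Int.ModEq.mul_right _ (by unfold Int.ModEq at hp ⊢; omega))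
          have := hc (-j) i
          rw [neg_neg, e] at this
          simp only [Matrix.of_apply, hp, hp', if_true]
          exact this
        · have hp' : ¬ j - -i ≡ ε [ZMOD 2] := by unfold Int.ModEq at hp ⊢; omega
          simp only [Matrix.of_apply, hp, hp', if_false]
          simp
    refine Submodule.mem_sup.2 ⟨_, key 0, _, key 1, ?_⟩
    ext i j
    simp only [Matrix.add_apply]
    by_cases hp : j - i ≡ 0 [ZMOD 2]
    · have hp' : ¬ j - i ≡ 1 [ZMOD 2] := by unfold Int.ModEq at hp ⊢; omega
      simp [hp, hp']
    · have hp' : j - i ≡ 1 [ZMOD 2] := by unfold Int.ModEq at hp ⊢; omega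
      simp [hp, hp']

theorem gram_ne_zero {i : ℤ} (h : i ≠ 0) : gram i ≠ 0 := by
  unfold gram
  split_ifs
  · simpa using h
  · exact one_ne_zero

theorem bracket_mem_algA {A B : Matrix ℤ ℤ ℂ} (hA : A ∈ algA) (hB : B ∈ algA) :
    bracket A B ∈ algA := by
  obtain ⟨⟨a, ha⟩, za⟩ := hA
  obtain ⟨⟨b, hb⟩, zb⟩ := hB
  refine ⟨⟨a + b, fun i k h => ?_⟩, fun i k h => ?_⟩
  · refine finsum_eq_zero_of_forall_eq_zero fun j => ?_
    have tri : |k - i| ≤ |j - i| + |k - j| := by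
      have := abs_add_le (j - i) (k - j)
      rwa [show j - i + (k - j) = k - i by ring] at this
    have h1 : A i j * B j k = 0 := by
      by_cases hh : a < |j - i|
      · rw [ha i j hh, zero_mul]
      · rw [hb j k (by omega), mul_zero]
    have h2 : B i j * A j k = 0 := by
      by_cases hh : b < |j - i|
      · rw [hb i j hh, zero_mul]
      · rw [ha j k (by omega), mul_zero]
    rw [h1, h2, mul_zero, sub_zero]
  · refine finsum_eq_zero_of_forall_eq_zero fun j => ?_
    rcases h with h | h
    · rw [za i j (Or.inl h), zb i j (Or.inl h)]; ring
    · rw [za j k (Or.inr h), zb j k (Or.inr h)]; ring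

theorem sgn_sq_exp (p q k : ℤ) :
    sgn ((p + q) * q) * sgn ((q + k) * k) = sgn ((p + k) * k) * sgn ((q - p) * (k - q)) := by
  rw [← sgn_add, ← sgn_add]
  apply sgn_congr
  rw [Int.modEq_iff_dvd]
  exact ⟨-(q * q), by ring⟩

theorem bracket_mem_algC {A B : Matrix ℤ ℤ ℂ} (hA : A ∈ algC) (hB : B ∈ algC) :
    bracket A B ∈ algC := by
  rw [mem_algC_iff] at hA hB ⊢
  obtain ⟨hA, cA⟩ := hA
  obtain ⟨hB, cB⟩ := hB
  have hAB := bracket_mem_algA hA hB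
  refine ⟨hAB, fun i k => ?_⟩
  by_cases hi : i = 0
  · rw [hAB.2 i k (Or.inl hi), hAB.2 (-k) (-i) (Or.inr (by omega))]; ring
  unfold bracket
  rw [← finsum_comp_equiv (Equiv.neg ℤ) (f := fun j =>
    A (-k) j * B j (-i) - sgn ((j - -k) * (-i - j)) * (B (-k) j * A j (-i)))]
  rw [mul_comm, ← smul_eq_mul, smul_finsum, ← smul_eq_mul (gram k), smul_finsum,
    ← smul_eq_mul, smul_finsum]
  refine finsum_congr fun j => ?_
  simp only [smul_eq_mul, Equiv.neg_apply]
  by_cases hj : j = 0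
  · subst hj
    rw [hA.2 i 0 (Or.inr rfl), hB.2 i 0 (Or.inr rfl), hA.2 (-k) (-0) (Or.inr neg_zero),
      hB.2 (-k) (-0) (Or.inr neg_zero)]
    ring
  have gj := gram_ne_zero hj
  have key := sgn_sq_exp i j k
  have sw : sgn ((-j - -k) * (-i - -j)) = sgn ((j - i) * (k - j)) := by congr 1; ring
  have sq : sgn ((j - i) * (k - j)) * sgn ((j - i) * (k - j)) = 1 := by
    rw [← sgn_add]; exact sgn_even ⟨_, rfl⟩
  have a1 := cA i j
  have a2 := cA j k
  have b1 := cB i j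
  have b2 := cB j k
  rw [sw]
  generalize sgn ((j - i) * (k - j)) = t at *
  generalize sgn ((i + j) * j) = s1 at *
  generalize sgn ((j + k) * k) = s2 at *
  generalize sgn ((i + k) * k) = s3 at *
  have e1 : gram i * (A i j * B j k) = s3 * t * gram k * (B (-k) (-j) * A (-j) (-i)) := by
    apply mul_left_cancel₀ gj
    linear_combination (B j k * gram j) * a1 + (-s1 * gram j * A (-j) (-i)) * b2 +
      (gram j * gram k * A (-j) (-i) * B (-k) (-j)) * key
  have e2 : gram i * (B i j * A j k) = s3 * t * gram k * (A (-k) (-j) * B (-j) (-i)) := by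
    apply mul_left_cancel₀ gj
    linear_combination (A j k * gram j) * b1 + (-s1 * gram j * B (-j) (-i)) * a2 +
      (gram j * gram k * B (-j) (-i) * A (-k) (-j)) * key
  linear_combination e1 - t * e2 - s3 * gram k * A (-k) (-j) * B (-j) (-i) * sq

/-! ### The central extension and its modules -/

/-- The central extension `Ĉ = 𝒞 ⊕ ℂ C`; the pair `(A, d)` is the element `A + d C`. -/
abbrev CHat : Type := ↥algC × ℂ

/-- The super-bracket `[A + a C, B + b C] = [A, B] + α(A, B) C` of `Ĉ`. -/
noncomputable def hatBracket (x y : CHat) : CHat :=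
  (⟨bracket x.1 y.1, bracket_mem_algC x.1.2 y.1.2⟩, cocycle x.1 y.1)

/-- The homogeneous component of `Ĉ` of degree `p / 2`: `e_{ij}` has degree `j - i`, and `C` has
degree `0`. -/
def deg (p : ℤ) : Submodule ℂ CHat where
  carrier := {x | (∀ i j, j - i ≠ p → (x.1 : Matrix ℤ ℤ ℂ) i j = 0) ∧ (p ≠ 0 → x.2 = 0)}
  zero_mem' := ⟨fun _ _ _ => rfl, fun _ => rfl⟩
  add_mem' := by
    rintro x y ⟨hx, hx'⟩ ⟨hy, hy'⟩
    refine ⟨fun i j h => ?_, fun h => ?_⟩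
    · have : ((x + y).1 : Matrix ℤ ℤ ℂ) i j = (x.1 : Matrix ℤ ℤ ℂ) i j + (y.1 : Matrix ℤ ℤ ℂ) i j :=
        rfl
      rw [this, hx i j h, hy i j h, add_zero]
    · rw [Prod.snd_add, hx' h, hy' h, add_zero]
  smul_mem' := by
    rintro c x ⟨hx, hx'⟩
    refine ⟨fun i j h => ?_, fun h => ?_⟩
    · have : ((c • x).1 : Matrix ℤ ℤ ℂ) i j = c * (x.1 : Matrix ℤ ℤ ℂ) i j := rfl
      rw [this, hx i j h, mul_zero]
    · rw [Prod.smul_snd, hx' h, smul_zero]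

/-- `Ĉ_- = ⊕_{p < 0} Ĉ_p`. -/
noncomputable def negPart : Submodule ℂ CHat := ⨆ p : {p : ℤ // p < 0}, deg p

/-- `Ĉ_+ = ⊕_{p > 0} Ĉ_p`. -/
noncomputable def posPart : Submodule ℂ CHat := ⨆ p : {p : ℤ // 0 < p}, deg p

/-- The fundamental weight `ω_s`, `ω_s (∑_{r > 0} a_r ẽ_{rr} + d C) = a_s` for `s > 0`, where
`ẽ_{rr} = e_{rr} - e_{-r,-r}`. -/
noncomputable def omega (s : ℤ) : Module.Dual ℂ (deg 0) where
  toFun h := (h.1.1 : Matrix ℤ ℤ ℂ) s s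
  map_add' _ _ := rfl
  map_smul' _ _ := rfl

/-- The fundamental weight `Λ_0`, `Λ_0 (∑_{r > 0} a_r ẽ_{rr} + d C) = d`. -/
noncomputable def Lambda0 : Module.Dual ℂ (deg 0) where
  toFun h := h.1.2
  map_add' _ _ := rfl
  map_smul' _ _ := rfl

section Modules

variable {M : Type*} [AddCommGroup M] [Module ℂ M]

/-- A `Ĉ`-module structure on `M`: a linear map `ρ : Ĉ → End M` with
`ρ [x, y] = ρ x ρ y - (-1)^{|x| |y|} ρ y ρ x` for homogeneous `x`, `y`. -/
def IsRep (ρ : CHat →ₗ[ℂ] Module.End ℂ M) : Prop :=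
  ∀ p q : ℤ, ∀ x ∈ deg p, ∀ y ∈ deg q,
    ρ (hatBracket x y) = ρ x * ρ y - sgn (p * q) • (ρ y * ρ x)

/-- Irreducibility: `M` is nonzero and has no submodules other than `0` and `M`. -/
def IsIrreducible (ρ : CHat →ₗ[ℂ] Module.End ℂ M) : Prop :=
  Nontrivial M ∧ ∀ N : Submodule ℂ M, (∀ x, ∀ m ∈ N, ρ x m ∈ N) → N = ⊥ ∨ N = ⊤

/-- `M` is a highest weight module with highest weight `ξ ∈ (Ĉ_0)^*` and highest weight vector `v`.
The last condition is `U(Ĉ_-) v = M`: the image of `U(Ĉ_-)` in `End M` is the unital subalgebra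
generated by the operators `ρ x`, `x ∈ Ĉ_-`. -/
structure IsHighestWeight (ρ : CHat →ₗ[ℂ] Module.End ℂ M) (ξ : Module.Dual ℂ (deg 0)) (v : M) :
    Prop where
  ne_zero : v ≠ 0
  weight : ∀ h : deg 0, ρ h v = ξ h • v
  pos_annihilates : ∀ x ∈ posPart, ρ x v = 0
  generates : ∀ m : M, ∃ u ∈ Algebra.adjoin ℂ (ρ '' (negPart : Set CHat)), u v = m

/-- `Monomial ρ v j m` says that `m = x₁ ⋯ x_k v` with `x_i ∈ Ĉ_{p_i}`, `p_i < 0` and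
`p₁ + ⋯ + p_k = j`. -/
inductive Monomial (ρ : CHat →ₗ[ℂ] Module.End ℂ M) (v : M) : ℤ → M → Prop
  | vac : Monomial ρ v 0 v
  | step {p j : ℤ} {x : CHat} {m : M} (hp : p < 0) (hx : x ∈ deg p) (hm : Monomial ρ v j m) :
      Monomial ρ v (p + j) (ρ x m)

/-- The component `M_j = U(Ĉ_-)_j v` of the grading of a highest weight module in which the
highest weight vector `v` has degree `0`. -/
def comp (ρ : CHat →ₗ[ℂ] Module.End ℂ M) (v : M) (j : ℤ) : Submodule ℂ M :=
  Submodule.span ℂ {m | Monomial ρ v j m}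

/-- Quasi-finiteness: every homogeneous component of the natural grading is finite dimensional. -/
def IsQuasiFinite (ρ : CHat →ₗ[ℂ] Module.End ℂ M) (v : M) : Prop :=
  ∀ j : ℤ, FiniteDimensional ℂ (comp ρ v j)

/-! ### The components `M_j` form a grading of a highest weight module -/

theorem hatBracket_mem_deg {p q : ℤ} {x y : CHat} (hx : x ∈ deg p) (hy : y ∈ deg q) :
    hatBracket x y ∈ deg (p + q) := by
  refine ⟨fun i k h => ?_, fun h => ?_⟩
  · refine finsum_eq_zero_of_forall_eq_zero fun j => ?_
    have h1 : (x.1 : Matrix ℤ ℤ ℂ) i j * (y.1 : Matrix ℤ ℤ ℂ) j k = 0 := by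
      by_cases hh : j - i = p
      · rw [hy.1 j k (by omega), mul_zero]
      · rw [hx.1 i j hh, zero_mul]
    have h2 : (y.1 : Matrix ℤ ℤ ℂ) i j * (x.1 : Matrix ℤ ℤ ℂ) j k = 0 := by
      by_cases hh : j - i = q
      · rw [hx.1 j k (by omega), mul_zero]
      · rw [hy.1 i j hh, zero_mul]
    rw [h1, h2, mul_zero, sub_zero]
  · refine finsum_eq_zero_of_forall_eq_zero fun i => ?_
    have : mul (bracket J x.1) y.1 i i = 0 := by
      refine finsum_eq_zero_of_forall_eq_zero fun j => ?_
      by_cases hh : j - i = p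
      · rw [hy.1 j i (by omega), mul_zero]
      · have : bracket J x.1 i j = 0 := by
          refine finsum_eq_zero_of_forall_eq_zero fun l => ?_
          have h1 : J i l * (x.1 : Matrix ℤ ℤ ℂ) l j = 0 := by
            by_cases hl : i = l
            · subst hl; rw [hx.1 i j hh, mul_zero]
            · rw [J, Matrix.diagonal_apply_ne _ hl, zero_mul]
          have h2 : (x.1 : Matrix ℤ ℤ ℂ) i l * J l j = 0 := by
            by_cases hl : l = j
            · subst hl; rw [hx.1 i l hh, zero_mul]
            · rw [J, Matrix.diagonal_apply_ne _ hl, mul_zero]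
          rw [h1, h2, mul_zero, sub_zero]
        rw [this, zero_mul]
    rw [this, mul_zero]

theorem bracket_diagonal (f : ℤ → ℂ) (A : Matrix ℤ ℤ ℂ) (i k : ℤ) :
    bracket (Matrix.diagonal f) A i k = (f i - f k) * A i k := by
  unfold bracket
  have h1 : ∀ j, Matrix.diagonal f i j * A j k -
      sgn ((j - i) * (k - j)) * (A i j * Matrix.diagonal f j k) =
      (if j = i then f i * A i k else 0) - (if j = k then f k * A i k else 0) := by
    intro j
    congr 1
    · by_cases h : j = i
      · subst h; simp
      · rw [Matrix.diagonal_apply_ne _ (Ne.symm h), if_neg h, zero_mul]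
    · by_cases h : j = k
      · subst h; simp [sgn, mul_comm]
      · rw [Matrix.diagonal_apply_ne _ h, if_neg h]; simp
  rw [finsum_congr h1, finsum_sub_distrib, finsum_eq_single _ i (fun j hj => if_neg hj),
    finsum_eq_single _ k (fun j hj => if_neg hj), if_pos rfl, if_pos rfl]
  · ring
  · exact (Set.finite_singleton i).subset fun j hj => by
      by_contra h; exact hj (if_neg h)
  · exact (Set.finite_singleton k).subset fun j hj => by
      by_contra h; exact hj (if_neg h)

theorem diagonal_mem_algC : (Matrix.diagonal fun i : ℤ => (i : ℂ)) ∈ algC := by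
  rw [mem_algC_iff]
  refine ⟨⟨⟨0, fun i j h => Matrix.diagonal_apply_ne _ ?_⟩, fun i j h => ?_⟩, fun i j => ?_⟩
  · rintro rfl; simp at h
  · by_cases e : i = j
    · subst e; have : i = 0 := by tauto
      subst this; simp
    · exact Matrix.diagonal_apply_ne _ e
  · by_cases e : i = j
    · subst e
      rw [sgn_even ⟨i * i, by ring⟩]
      simp only [Matrix.diagonal_apply_eq]
      push_cast
      ring
    · rw [Matrix.diagonal_apply_ne _ e, Matrix.diagonal_apply_ne _ (by omega)]
      ring

/-- The degree operator `∑_r r ẽ_{rr}` (up to the factor `2` of the encoding). -/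
noncomputable def degOp : CHat := (⟨_, diagonal_mem_algC⟩, 0)

theorem degOp_mem : degOp ∈ deg 0 :=
  ⟨fun i j h => Matrix.diagonal_apply_ne _ (by omega), fun _ => rfl⟩

theorem hatBracket_degOp {p : ℤ} {x : CHat} (hx : x ∈ deg p) :
    hatBracket degOp x = (-p : ℂ) • x := by
  refine Prod.ext (Subtype.ext ?_) ?_
  · ext i k
    have e : bracket (Matrix.diagonal fun i : ℤ => (i : ℂ)) x.1 i k =
        (-p : ℂ) * (x.1 : Matrix ℤ ℤ ℂ) i k := by
      rw [bracket_diagonal]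
      by_cases h : k - i = p
      · subst h; push_cast; ring
      · rw [hx.1 i k h]; ring
    exact e
  · have e : bracket J (Matrix.diagonal fun i : ℤ => (i : ℂ)) = 0 := by
      ext i k
      rw [J, bracket_diagonal]
      by_cases h : i = k
      · subst h; simp
      · rw [Matrix.diagonal_apply_ne _ h]; simp
    have e2 : cocycle (Matrix.diagonal fun i : ℤ => (i : ℂ)) x.1 = 0 := by
      unfold cocycle str mul
      rw [e]
      simp
    change cocycle (Matrix.diagonal fun i : ℤ => (i : ℂ)) x.1 = -p * x.2
    rw [e2]
    by_cases h : p = 0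
    · subst h; simp
    · rw [hx.2 h, mul_zero]

theorem IsRep.apply {ρ : CHat →ₗ[ℂ] Module.End ℂ M} (hρ : IsRep ρ) {p q : ℤ} {x y : CHat}
    (hx : x ∈ deg p) (hy : y ∈ deg q) (m : M) :
    ρ x (ρ y m) = ρ (hatBracket x y) m + sgn (p * q) • ρ y (ρ x m) := by
  rw [hρ p q x hx y hy]
  simp

theorem comp_le_eigenspace {ρ : CHat →ₗ[ℂ] Module.End ℂ M} (hρ : IsRep ρ)
    {ξ : Module.Dual ℂ (deg 0)} {v : M} (hv : IsHighestWeight ρ ξ v) (j : ℤ) :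
    comp ρ v j ≤ (ρ degOp).eigenspace (ξ ⟨degOp, degOp_mem⟩ - j) := by
  refine Submodule.span_le.2 fun m hm => ?_
  rw [SetLike.mem_coe, Module.End.mem_eigenspace_iff]
  induction hm with
  | vac => simpa using hv.weight ⟨degOp, degOp_mem⟩
  | step hp hx _ ih =>
    rw [hρ.apply degOp_mem hx, ih, hatBracket_degOp hx, zero_mul, sgn_even Even.zero]
    simp only [map_smul, LinearMap.smul_apply, one_smul]
    rw [← add_smul]
    congr 1
    push_cast
    ring

/-- `M = ⊕_j M_j`. -/
theorem comp_isInternal {ρ : CHat →ₗ[ℂ] Module.End ℂ M} (hρ : IsRep ρ)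
    {ξ : Module.Dual ℂ (deg 0)} {v : M} (hv : IsHighestWeight ρ ξ v) :
    DirectSum.IsInternal (comp ρ v) := by
  refine DirectSum.isInternal_submodule_of_iSupIndep_of_iSup_eq_top ?_ ?_
  · refine iSupIndep.mono ?_ (comp_le_eigenspace hρ hv)
    exact (Module.End.eigenspaces_iSupIndep (ρ degOp)).comp
      (f := fun j : ℤ => ξ ⟨degOp, degOp_mem⟩ - (j : ℂ)) fun a b h => by simpa using h
  · rw [eq_top_iff]
    intro m hm
    clear hm
    obtain ⟨u, hu, rfl⟩ := hv.generates m
    have hneg : ∀ x ∈ negPart, ∀ m ∈ ⨆ j, comp ρ v j, ρ x m ∈ ⨆ j, comp ρ v j := by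
      intro x hx m hm
      induction hx using Submodule.iSup_induction' with
      | mem p x hx =>
        induction hm using Submodule.iSup_induction' with
        | mem j m hm =>
          refine Submodule.mem_iSup_of_mem (p + j) ?_
          induction hm using Submodule.span_induction with
          | mem m hm => exact Submodule.subset_span (Monomial.step p.2 hx hm)
          | zero => rw [map_zero]; exact zero_mem _
          | add a b _ _ ha hb => rw [map_add]; exact add_mem ha hb
          | smul c a _ ha => rw [map_smul]; exact Submodule.smul_mem _ c ha
        | zero => rw [map_zero]; exact zero_mem _
        | add a b _ _ ha hb => rw [map_add]; exact add_mem ha hb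
      | zero => rw [map_zero]; exact zero_mem _
      | add a b _ _ ha hb => rw [map_add]; exact add_mem ha hb
    have hadj : ∀ m ∈ ⨆ j, comp ρ v j, u m ∈ ⨆ j, comp ρ v j := by
      induction hu using Algebra.adjoin_induction with
      | mem u hu => obtain ⟨x, hx, rfl⟩ := hu; exact hneg x hx
      | algebraMap c =>
        intro m hm
        rw [Module.algebraMap_end_apply]
        exact Submodule.smul_mem _ c hm
      | add a b _ _ ha hb => intro m hm; exact add_mem (ha m hm) (hb m hm)
      | mul a b _ _ ha hb => intro m hm; exact ha _ (hb m hm)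
    exact hadj v (Submodule.mem_iSup_of_mem 0 (Submodule.subset_span Monomial.vac))

/-- `Ĉ_p M_j ⊆ M_{p + j}`. -/
theorem apply_mem_comp {ρ : CHat →ₗ[ℂ] Module.End ℂ M} (hρ : IsRep ρ)
    {ξ : Module.Dual ℂ (deg 0)} {v : M} (hv : IsHighestWeight ρ ξ v) {p j : ℤ} {x : CHat}
    (hx : x ∈ deg p) {m : M} (hm : m ∈ comp ρ v j) : ρ x m ∈ comp ρ v (p + j) := by
  have hneg : ∀ {q : ℤ}, q < 0 → ∀ {y : CHat}, y ∈ deg q → ∀ {i : ℤ} {m : M},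
      m ∈ comp ρ v i → ρ y m ∈ comp ρ v (q + i) := by
    intro q hq y hy i m hm
    induction hm using Submodule.span_induction with
    | mem m hm => exact Submodule.subset_span (Monomial.step hq hy hm)
    | zero => rw [map_zero]; exact zero_mem _
    | add a b _ _ ha hb => rw [map_add]; exact add_mem ha hb
    | smul c a _ ha => rw [map_smul]; exact Submodule.smul_mem _ c ha
  have hmon : ∀ {j : ℤ} {m : M}, Monomial ρ v j m → ∀ {p : ℤ} {x : CHat}, x ∈ deg p →
      ρ x m ∈ comp ρ v (p + j) := by
    intro j m hm
    induction hm with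
    | vac =>
      intro p x hx
      rcases lt_trichotomy p 0 with h | h | h
      · exact hneg h hx (Submodule.subset_span Monomial.vac)
      · subst h
        have := hv.weight ⟨x, hx⟩
        simp only at this
        rw [this]
        exact Submodule.smul_mem _ _ (Submodule.subset_span Monomial.vac)
      · rw [hv.pos_annihilates x (Submodule.mem_iSup_of_mem (⟨p, h⟩ : {p : ℤ // 0 < p}) hx)]
        exact zero_mem _
    | @step q i y m hq hy _ ih =>
      intro p x hx
      rw [hρ.apply hx hy]
      refine add_mem ?_ (Submodule.smul_mem _ _ ?_)
      · have := ih (hatBracket_mem_deg hx hy)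
        rwa [add_assoc] at this
      · have := hneg hq hy (ih hx)
        rwa [show q + (p + i) = p + (q + i) by ring] at this
  induction hm using Submodule.span_induction with
  | mem m hm => exact hmon hm hx
  | zero => rw [map_zero]; exact zero_mem _
  | add a b _ _ ha hb => rw [map_add]; exact add_mem ha hb
  | smul c a _ ha => rw [map_smul]; exact Submodule.smul_mem _ c ha

end Modules

end InfSPO

/-!
Only two of the implications have content; they are proved in the doubled encoding, so that
`Ĉ_{-1/2}` is `deg (-1)`.

*Finite-dimensionality of `Ĉ_{-1/2} v` bounds the weight.* Elements of `Ĉ_{-1/2}` are sequences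
`a = (a_i)_{i ≥ 2}`, elements of `Ĉ_{1/2}` are sequences `b`, and the bracket of the two is the
diagonal element with entries `c_i + c_{i+1}`, where `c` is the pointwise product of `a` with a
shift of `b` (`hatBracket_posDiag_one_neg_one`). If the sequences modulo those that annihilate `v`
form a finite-dimensional space, then some sequence of values of a nonzero polynomial annihilates
`v`. It has finitely many zeros, so by varying `b` every `c` supported beyond them is obtained, and
hence every diagonal element supported beyond them. Since `Ĉ_{1/2} v = 0`, the weight kills all of
these (`exists_weight_vanishing`).

*A finitely supported weight is quasi-finite.* Call a matrix far if its entries vanish in a large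
range of rows and columns around `0`. In a fixed degree far matrices never cross from negative to
positive indices, so the cocycle vanishes on them, and brackets with homogeneous elements keep them
far with a controlled loss (`IsFar.hatBracket`). By induction on the degree, a far element of
negative degree maps `v` to a singular vector, which is zero by irreducibility
(`IsFar.apply_highestWeight_eq_zero`, `eq_zero_of_singular`). Commuting far elements through
monomials shows that sufficiently far elements of any degree kill any given component of the module
(`IsFar.apply_comp_eq_zero`). Far elements have finite codimension in each degree, so the components
are finite dimensional by induction (`isQuasiFinite_of_isFar`).
-/

/-! ### Elements of `Ĉ` far from the centre of the matrix -/

namespace InfSPO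

/-- `x` is a matrix without central part whose nonzero entries all have both their row and their
column outside `[-n, n]`. For `x` of degree `p` and `n ≥ |p|`, no entry of `x` crosses from
negative to positive indices. -/
def IsFar (n : ℤ) (x : CHat) : Prop :=
  x.2 = 0 ∧ ∀ i j, |i| ≤ n ∨ |j| ≤ n → (x.1 : Matrix ℤ ℤ ℂ) i j = 0

theorem IsFar.hatBracket {n p q : ℤ} {x y : CHat} (hy : y ∈ deg p) (hx : x ∈ deg q)
    (hn : |p| ≤ n) (hfar : IsFar n y) : IsFar (n - |q|) (hatBracket y x) := by
  obtain ⟨-, hfar⟩ := hfar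
  constructor
  · -- the cocycle sees only entries between indices of different sign
    refine finsum_eq_zero_of_forall_eq_zero fun i => ?_
    have : mul (bracket J y.1) x.1 i i = 0 := by
      refine finsum_eq_zero_of_forall_eq_zero fun j => ?_
      rw [J, bracket_diagonal]
      by_cases hp : j - i = p
      · by_cases hi : |i| ≤ n
        · rw [hfar i j (Or.inl hi)]; ring
        · -- `|j - i| = |p| ≤ n < |i|`, so `i` and `j` have the same sign
          have : (i ≤ 0 ↔ j ≤ 0) := by
            rcases abs_cases p with h | h <;> rcases abs_cases i with h' | h' <;> omega
          simp only [this, sub_self, zero_mul]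
      · rw [hy.1 i j hp]; ring
    rw [this, mul_zero]
  · intro i k h
    refine finsum_eq_zero_of_forall_eq_zero fun j => ?_
    have tri : ∀ a b : ℤ, b - a = q → |a| ≤ |b| + |q| ∧ |b| ≤ |a| + |q| := by
      rintro a b rfl
      constructor
      · have := abs_sub_abs_le_abs_sub a b
        rw [abs_sub_comm] at this; omega
      · have := abs_sub_abs_le_abs_sub b a
        omega
    have hq := abs_nonneg q
    have h1 : (y.1 : Matrix ℤ ℤ ℂ) i j * (x.1 : Matrix ℤ ℤ ℂ) j k = 0 := by
      by_cases hh : k - j = q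
      · rw [hfar i j (by have := tri j k hh; omega), zero_mul]
      · rw [hx.1 j k hh, mul_zero]
    have h2 : (x.1 : Matrix ℤ ℤ ℂ) i j * (y.1 : Matrix ℤ ℤ ℂ) j k = 0 := by
      by_cases hh : j - i = q
      · rw [hfar j k (by have := tri i j hh; omega), mul_zero]
      · rw [hx.1 i j hh, zero_mul]
    rw [h1, h2, mul_zero, sub_zero]

/-- The entries of an element of `deg p` in the rows `[-(n + |p|), n + |p|]`, together with its
central part. -/
def nearPart (n p : ℤ) : CHat →ₗ[ℂ] (Finset.Icc (-(n + |p|)) (n + |p|) → ℂ) × ℂ where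
  toFun x := (fun i => (x.1 : Matrix ℤ ℤ ℂ) i (i + p), x.2)
  map_add' _ _ := rfl
  map_smul' _ _ := rfl

/-- The far elements have finite codimension in each degree. -/
theorem isFar_of_nearPart_eq_zero {n p : ℤ} {x : CHat} (hx : x ∈ deg p)
    (h : nearPart n p x = 0) : IsFar n x := by
  refine ⟨congrArg Prod.snd h, fun i j hij => ?_⟩
  by_cases hp : j - i = p
  · obtain rfl : j = i + p := by omega
    have hi : i ∈ Finset.Icc (-(n + |p|)) (n + |p|) := by
      rw [Finset.mem_Icc]
      rcases abs_cases p with h' | h' <;> rcases abs_cases i with h'' | h'' <;>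
        rcases abs_cases (i + p) with h3 | h3 <;> omega
    exact congrFun (congrArg Prod.fst h) ⟨i, hi⟩
  · exact hx.1 i j hp

/-! ### Elements of `Ĉ` concentrated on one diagonal -/

/-- The part of `A` on the diagonal of degree `p`. -/
def diagPart (p : ℤ) (A : Matrix ℤ ℤ ℂ) : Matrix ℤ ℤ ℂ :=
  fun i j => if j - i = p then A i j else 0

theorem diagPart_mem_algC (p : ℤ) {A : Matrix ℤ ℤ ℂ} (hA : A ∈ algC) : diagPart p A ∈ algC := by
  rw [mem_algC_iff] at hA ⊢
  obtain ⟨⟨⟨b, hb⟩, hz⟩, hc⟩ := hA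
  refine ⟨⟨⟨b, fun i j h => ?_⟩, fun i j h => ?_⟩, fun i j => ?_⟩
  · simp [diagPart, hb i j h]
  · simp [diagPart, hz i j h]
  · have e : -i - -j = j - i := by ring
    simp only [diagPart, e]
    split_ifs
    · exact hc i j
    · ring

theorem iSup_deg_eq_top : ⨆ p, deg p = ⊤ := by
  rw [eq_top_iff]
  rintro ⟨⟨A, hA⟩, d⟩ -
  obtain ⟨b, hb⟩ := ((mem_algC_iff A).1 hA).1.1
  have e : ((⟨A, hA⟩, d) : CHat) =
      (∑ p ∈ Finset.Icc (-b) b, (⟨diagPart p A, diagPart_mem_algC p hA⟩, 0)) + (0, d) := by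
    refine Prod.ext (Subtype.ext ?_) ?_
    · ext i j
      simp only [Prod.fst_add, Prod.fst_sum, add_zero, Submodule.coe_sum, Matrix.sum_apply,
        diagPart]
      rw [Finset.sum_ite_eq]
      split_ifs with h
      · rfl
      · refine hb i j ?_
        rw [Finset.mem_Icc, ← abs_le] at h
        omega
    · simp [Prod.snd_sum]
  rw [e]
  refine add_mem (sum_mem fun p _ => Submodule.mem_iSup_of_mem p ⟨fun i j h => if_neg h,
    fun _ => rfl⟩) (Submodule.mem_iSup_of_mem 0 ⟨fun _ _ _ => rfl, fun h => absurd rfl h⟩)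

theorem gram_mul_gram_neg {i : ℤ} (h : i ≠ 0) : gram i * gram (-i) = -sgn i := by
  unfold gram
  by_cases he : Even i
  · rw [if_pos he, if_pos he.neg, sgn_even he]
    rcases lt_or_gt_of_ne h with h | h
    · rw [Int.sign_eq_neg_one_of_neg h, Int.sign_eq_one_of_pos (by omega)]; simp
    · rw [Int.sign_eq_one_of_pos h, Int.sign_eq_neg_one_of_neg (by omega)]; simp
  · rw [if_neg he, if_neg (by simpa using he), sgn_odd (Int.not_even_iff_odd.1 he)]; simp

/-- The matrix of degree `p` with the entries `a_i` at `(i, i + p)` for positive `i`, `i + p`, the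
entries with both indices negative which make it an element of `𝒞`, and no other entries. -/
noncomputable def posDiagMatrix (p : ℤ) (a : ℤ → ℂ) : Matrix ℤ ℤ ℂ := fun i j =>
  if j - i = p then
    if 0 < i ∧ 0 < j then a i
    else if i < 0 ∧ j < 0 then -sgn ((i + j) * j) * gram j / gram i * a (-j) else 0
  else 0

theorem posDiagMatrix_mem_algC (p : ℤ) (a : ℤ → ℂ) : posDiagMatrix p a ∈ algC := by
  rw [mem_algC_iff]
  refine ⟨⟨⟨|p|, fun i j h => ?_⟩, fun i j h => ?_⟩, fun i j => ?_⟩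
  · refine if_neg ?_
    rintro rfl
    exact lt_irrefl _ h
  · unfold posDiagMatrix
    rw [if_neg (show ¬ (0 < i ∧ 0 < j) by omega), if_neg (show ¬ (i < 0 ∧ j < 0) by omega), ite_self]
  · have e : -i - -j = j - i := by ring
    simp only [posDiagMatrix, e]
    by_cases hp : j - i = p
    swap
    · simp only [if_neg hp]; ring
    simp only [if_pos hp]
    by_cases h1 : 0 < i ∧ 0 < j
    · have gi := gram_ne_zero (show i ≠ 0 by omega)
      have gj := gram_ne_zero (show -j ≠ 0 by omega)
      rw [if_pos h1, if_neg (show ¬ (0 < -j ∧ 0 < -i) by omega),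
        if_pos (show -j < 0 ∧ -i < 0 by omega), neg_neg]
      have ei := gram_mul_gram_neg (show i ≠ 0 by omega)
      have ej := gram_mul_gram_neg (show j ≠ 0 by omega)
      have es : sgn ((i + j) * j) * sgn ((-j + -i) * -i) * sgn j = sgn i := by
        rw [← sgn_add, ← sgn_add]
        apply sgn_congr
        rw [Int.modEq_iff_dvd]
        have : i - ((i + j) * j + (-j + -i) * -i + j) = -(i + j) * (i + j + 1) + 2 * i := by ring
        rw [this]
        refine dvd_add ?_ ⟨_, rfl⟩
        rw [neg_mul]
        exact (Int.even_mul_succ_self (i + j)).two_dvd.neg_right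
      have sj : sgn j * sgn j = 1 := by rw [← sgn_add]; exact sgn_even ⟨_, rfl⟩
      have gj2 : gram (-j) * gram (-j) = 1 := by
        unfold gram
        split_ifs
        · rw [Int.sign_eq_neg_one_of_neg (show -j < 0 by omega)]; simp
        · simp
      have gi2 : gram i * gram i = 1 := by
        unfold gram
        split_ifs
        · rw [Int.sign_eq_one_of_pos h1.1]; simp
        · simp
      have key : gram i = sgn ((i + j) * j) * sgn ((-j + -i) * -i) * gram j * gram (-i) /
          gram (-j) := by
        rw [eq_div_iff gj]
        generalize sgn ((i + j) * j) = s1 at *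
        generalize sgn ((-j + -i) * -i) = s2 at *
        have h3 : gram (-i) = -sgn i * gram i := by
          linear_combination gram i * ei - gram (-i) * gi2
        have h4 : gram j = -sgn j * gram (-j) := by
          linear_combination gram (-j) * ej - gram j * gj2
        have si : sgn i * sgn i = 1 := by rw [← sgn_add]; exact sgn_even ⟨_, rfl⟩
        rw [h3, h4]
        linear_combination -(gram i * gram (-j)) * si -
          sgn i * gram i * gram (-j) * es
      calc a i * gram i = a i * (sgn ((i + j) * j) * sgn ((-j + -i) * -i) * gram j * gram (-i) /
          gram (-j)) := by rw [← key]
        _ = _ := by field_simp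
    · by_cases h2 : i < 0 ∧ j < 0
      · have gi := gram_ne_zero (show i ≠ 0 by omega)
        rw [if_neg h1, if_pos h2, if_pos (show 0 < -j ∧ 0 < -i by omega)]
        field_simp
      · rw [if_neg h1, if_neg h2, if_neg (show ¬ (0 < -j ∧ 0 < -i) by omega),
          if_neg (show ¬ (-j < 0 ∧ -i < 0) by omega)]
        ring

/-- `posDiagMatrix` as a linear map to `Ĉ`. -/
noncomputable def posDiag (p : ℤ) : (ℤ → ℂ) →ₗ[ℂ] CHat where
  toFun a := (⟨posDiagMatrix p a, posDiagMatrix_mem_algC p a⟩, 0)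
  map_add' a b := by
    refine Prod.ext (Subtype.ext ?_) (add_zero _).symm
    ext i j
    change posDiagMatrix p (a + b) i j = posDiagMatrix p a i j + posDiagMatrix p b i j
    simp only [posDiagMatrix, Pi.add_apply]
    split_ifs <;> ring
  map_smul' c a := by
    refine Prod.ext (Subtype.ext ?_) (mul_zero _).symm
    ext i j
    change posDiagMatrix p (c • a) i j = c * posDiagMatrix p a i j
    simp only [posDiagMatrix, Pi.smul_apply, smul_eq_mul]
    split_ifs <;> ring

theorem posDiag_mem (p : ℤ) (a : ℤ → ℂ) : posDiag p a ∈ deg p :=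
  ⟨fun _ _ h => if_neg h, fun _ => rfl⟩

theorem posDiag_apply_of_pos (p : ℤ) (a : ℤ → ℂ) {i j : ℤ} (hi : 0 < i) (hj : 0 < j) :
    ((posDiag p a).1 : Matrix ℤ ℤ ℂ) i j = if j - i = p then a i else 0 := by
  change posDiagMatrix p a i j = _
  simp only [posDiagMatrix, hi, hj, and_self, if_true]

/-- An element of `Ĉ_0` is determined by its positive diagonal entries and its central part. -/
theorem deg_zero_ext {x y : CHat} (hx : x ∈ deg 0) (hy : y ∈ deg 0)
    (h : ∀ i, 0 < i → (x.1 : Matrix ℤ ℤ ℂ) i i = (y.1 : Matrix ℤ ℤ ℂ) i i) (h2 : x.2 = y.2) :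
    x = y := by
  obtain ⟨⟨A, hA⟩, a⟩ := x
  obtain ⟨⟨B, hB⟩, b⟩ := y
  refine Prod.ext (Subtype.ext ?_) h2
  have hA' := (mem_algC_iff A).1 hA
  have hB' := (mem_algC_iff B).1 hB
  ext i j
  change A i j = B i j
  by_cases hij : j - i = 0
  · obtain rfl : j = i := by omega
    rcases lt_trichotomy j 0 with hj | rfl | hj
    · have h3 := hA'.2 j j
      have h4 := hB'.2 j j
      have h5 : A (-j) (-j) = B (-j) (-j) := h (-j) (by omega)
      rw [h5, ← h4] at h3
      exact mul_right_cancel₀ (gram_ne_zero hj.ne) h3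
    · rw [hA'.1.2 0 0 (Or.inl rfl), hB'.1.2 0 0 (Or.inl rfl)]
    · exact h j hj
  · exact (hx.1 i j hij).trans (hy.1 i j hij).symm

/-- The bracket of an element of degree `1` with an element of degree `-1`. Both are odd, so the
bracket is an anticommutator; it has no central part because neither matrix has an entry that
crosses from negative to positive indices. -/
theorem hatBracket_posDiag_one_neg_one (a b : ℤ → ℂ) (ha : a 1 = 0) :
    hatBracket (posDiag 1 b) (posDiag (-1) a) =
      posDiag 0 fun i => b i * a (i + 1) + a i * b (i - 1) := by
  refine deg_zero_ext (by simpa using hatBracket_mem_deg (posDiag_mem 1 b) (posDiag_mem (-1) a))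
    (posDiag_mem 0 _) (fun i hi => ?_) ?_
  · rw [posDiag_apply_of_pos 0 _ hi hi, if_pos (sub_self i)]
    change ∑ᶠ j, (posDiagMatrix 1 b i j * posDiagMatrix (-1) a j i -
      sgn ((j - i) * (i - j)) * (posDiagMatrix (-1) a i j * posDiagMatrix 1 b j i)) = _
    rw [finsum_eq_sum_of_support_subset (s := {i + 1, i - 1}), Finset.sum_pair (by omega)]
    · have s1 : sgn ((i - 1 - i) * (i - (i - 1))) = -1 := sgn_odd ⟨-1, by ring⟩
      rw [s1]
      simp only [posDiagMatrix]
      rw [if_pos (show i + 1 - i = 1 by ring), if_pos (show 0 < i ∧ 0 < i + 1 by omega),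
        if_pos (show i - (i + 1) = -1 by ring), if_pos (show 0 < i + 1 ∧ 0 < i by omega),
        if_neg (show ¬ i + 1 - i = -1 by omega), if_neg (show ¬ i - 1 - i = 1 by omega),
        if_pos (show i - 1 - i = -1 by ring), if_pos (show i - (i - 1) = 1 by ring)]
      by_cases h : i = 1
      · subst h
        simp [ha]
      · have h' : 0 < i - 1 := by omega
        simp only [hi, h', and_self, if_true]
        ring
    · intro j hj
      by_contra hn
      refine hj ?_
      simp only [Finset.coe_insert, Finset.coe_singleton, Set.mem_insert_iff,
        Set.mem_singleton_iff, not_or] at hn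
      simp only [posDiagMatrix]
      rw [if_neg (show ¬ j - i = 1 by omega), if_neg (show ¬ j - i = -1 by omega)]
      ring
  · refine finsum_eq_zero_of_forall_eq_zero fun i => ?_
    have : mul (bracket J (posDiag 1 b).1) (posDiag (-1) a).1 i i = 0 := by
      refine finsum_eq_zero_of_forall_eq_zero fun j => ?_
      have : bracket J (posDiag 1 b).1 i j = 0 := by
        rw [J, bracket_diagonal]
        change _ * posDiagMatrix 1 b i j = 0
        unfold posDiagMatrix
        split_ifs <;> first | omega | simp
      rw [this, zero_mul]
    rw [this, mul_zero]

variable {M : Type*} [AddCommGroup M] [Module ℂ M]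

/-! ### Singular vectors and the shape of the grading -/

theorem Monomial.eq_or_neg {ρ : CHat →ₗ[ℂ] Module.End ℂ M} {v : M} {j : ℤ} {m : M}
    (h : Monomial ρ v j m) : (j = 0 ∧ m = v) ∨ j < 0 := by
  induction h with
  | vac => exact Or.inl ⟨rfl, rfl⟩
  | step hp _ _ ih => right; omega

/-- If `S` is stable under `Ĉ_0` and annihilated by `Ĉ_+`, then `U(Ĉ_-) S` is a submodule. -/
theorem apply_mem_span_monomial {ρ : CHat →ₗ[ℂ] Module.End ℂ M} (hρ : IsRep ρ)
    {S : Submodule ℂ M} (h0 : ∀ x ∈ deg 0, ∀ w ∈ S, ρ x w ∈ S)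
    (hpos : ∀ p, 0 < p → ∀ x ∈ deg p, ∀ w ∈ S, ρ x w = 0) (x : CHat) {m : M}
    (hm : m ∈ Submodule.span ℂ {m | ∃ w ∈ S, ∃ i, Monomial ρ w i m}) :
    ρ x m ∈ Submodule.span ℂ {m | ∃ w ∈ S, ∃ i, Monomial ρ w i m} := by
  set T := Submodule.span ℂ {m | ∃ w ∈ S, ∃ i, Monomial ρ w i m} with hT
  have hneg : ∀ {q : ℤ}, q < 0 → ∀ {y : CHat}, y ∈ deg q → ∀ {m : M}, m ∈ T → ρ y m ∈ T := by
    intro q hq y hy m hm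
    induction hm using Submodule.span_induction with
    | mem m hm =>
      obtain ⟨w, hw, i, hm⟩ := hm
      exact Submodule.subset_span ⟨w, hw, _, Monomial.step hq hy hm⟩
    | zero => rw [map_zero]; exact zero_mem _
    | add a b _ _ ha hb => rw [map_add]; exact add_mem ha hb
    | smul c a _ ha => rw [map_smul]; exact Submodule.smul_mem _ c ha
  have hmon : ∀ w ∈ S, ∀ {j : ℤ} {m : M}, Monomial ρ w j m → ∀ {p : ℤ} {x : CHat}, x ∈ deg p →
      ρ x m ∈ T := by
    intro w hw j m hm
    induction hm with
    | vac =>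
      intro p x hx
      rcases lt_trichotomy p 0 with h | h | h
      · exact hneg h hx (Submodule.subset_span ⟨w, hw, _, Monomial.vac⟩)
      · subst h
        exact Submodule.subset_span ⟨_, h0 x hx w hw, _, Monomial.vac⟩
      · rw [hpos p h x hx w hw]
        exact zero_mem _
    | @step q i y m hq hy _ ih =>
      intro p x hx
      rw [hρ.apply hx hy]
      exact add_mem (ih (hatBracket_mem_deg hx hy)) (Submodule.smul_mem _ _ (hneg hq hy (ih hx)))
  have hx : x ∈ ⨆ p, deg p := iSup_deg_eq_top ▸ Submodule.mem_top
  induction hx using Submodule.iSup_induction' with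
  | mem p x hx =>
    induction hm using Submodule.span_induction with
    | mem m hm =>
      obtain ⟨w, hw, i, hm⟩ := hm
      exact hmon w hw hm hx
    | zero => rw [map_zero]; exact zero_mem _
    | add a b _ _ ha hb => rw [map_add]; exact add_mem ha hb
    | smul c a _ ha => rw [map_smul]; exact Submodule.smul_mem _ c ha
  | zero => rw [map_zero]; exact zero_mem _
  | add a b _ _ ha hb => rw [map_add]; exact add_mem ha hb

/-- An irreducible highest weight module has no nonzero vector of negative degree that is
annihilated by `Ĉ_+`: such vectors of a fixed degree generate a submodule that avoids `v`. -/
theorem eq_zero_of_singular {ρ : CHat →ₗ[ℂ] Module.End ℂ M} (hρ : IsRep ρ)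
    (hirr : IsIrreducible ρ) {ξ : Module.Dual ℂ (deg 0)} {v : M} (hv : IsHighestWeight ρ ξ v)
    {j : ℤ} (hj : j < 0) {w : M} (hw : w ∈ comp ρ v j)
    (hpos : ∀ p, 0 < p → ∀ x ∈ deg p, ρ x w = 0) : w = 0 := by
  let S : Submodule ℂ M :=
    { carrier := {w | w ∈ comp ρ v j ∧ ∀ p, 0 < p → ∀ x ∈ deg p, ρ x w = 0}
      zero_mem' := ⟨zero_mem _, fun _ _ _ _ => map_zero _⟩
      add_mem' := fun {a b} ha hb => ⟨add_mem ha.1 hb.1, fun p hp x hx => by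
        rw [map_add, ha.2 p hp x hx, hb.2 p hp x hx, add_zero]⟩
      smul_mem' := fun c a ha => ⟨Submodule.smul_mem _ c ha.1, fun p hp x hx => by
        rw [map_smul, ha.2 p hp x hx, smul_zero]⟩ }
  have hS0 : ∀ x ∈ deg 0, ∀ w ∈ S, ρ x w ∈ S := by
    intro x hx w hw
    refine ⟨by simpa using apply_mem_comp hρ hv hx hw.1, fun p hp y hy => ?_⟩
    rw [hρ.apply hy hx, hw.2 p hp y hy, map_zero, smul_zero, add_zero]
    exact hw.2 (p + 0) (by omega) _ (hatBracket_mem_deg hy hx)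
  have hST := fun x m => apply_mem_span_monomial hρ hS0 (fun p hp x hx w hw => hw.2 p hp x hx) x
    (m := m)
  have hle : Submodule.span ℂ {m | ∃ w ∈ S, ∃ i, Monomial ρ w i m} ≤
      ⨆ i, ⨆ (_ : i ≠ 0), comp ρ v i := by
    refine Submodule.span_le.2 ?_
    rintro m ⟨w, hw, i, hm⟩
    have hmem : m ∈ comp ρ v (i + j) := by
      induction hm with
      | vac => simpa using hw.1
      | step _ hx _ ih => rw [add_assoc]; exact apply_mem_comp hρ hv hx ih
    have hi := hm.eq_or_neg
    exact Submodule.mem_iSup_of_mem (i + j)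
      (Submodule.mem_iSup_of_mem (show i + j ≠ 0 by omega) hmem)
  have hdisj : Disjoint (comp ρ v 0) (⨆ i, ⨆ (_ : i ≠ 0), comp ρ v i) :=
    (comp_isInternal hρ hv).submodule_iSupIndep 0
  have hwT : w ∈ Submodule.span ℂ {m | ∃ w ∈ S, ∃ i, Monomial ρ w i m} :=
    Submodule.subset_span ⟨w, ⟨hw, hpos⟩, 0, Monomial.vac⟩
  -- the submodule generated by `S` meets the degree-zero component only in `0`
  rcases hirr.2 _ hST with h | h
  · rw [h] at hwT
    exact (Submodule.mem_bot ℂ).1 hwT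
  · refine absurd ?_ hv.ne_zero
    exact Submodule.disjoint_def.1 hdisj v (Submodule.subset_span Monomial.vac)
      (hle (h ▸ Submodule.mem_top))

/-! ### Finitely supported weights are quasi-finite -/

/-- If `ξ` kills the far diagonal elements, then far elements of negative degree kill `v`: by
induction on the degree, they map `v` to singular vectors. -/
theorem IsFar.apply_highestWeight_eq_zero {ρ : CHat →ₗ[ℂ] Module.End ℂ M} (hρ : IsRep ρ)
    (hirr : IsIrreducible ρ) {ξ : Module.Dual ℂ (deg 0)} {v : M} (hv : IsHighestWeight ρ ξ v)
    {n₀ : ℤ} (hn₀ : 0 ≤ n₀) (hξ : ∀ h : deg 0, IsFar n₀ h → ξ h = 0) (k : ℕ) :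
    ∀ n, n₀ + k ≤ n → ∀ y ∈ deg (-k), IsFar n y → ρ y v = 0 := by
  induction k using Nat.strong_induction_on with
  | _ k ih =>
    intro n hn y hy hfar
    rcases Nat.eq_zero_or_pos k with rfl | hk
    · have hy0 : y ∈ deg 0 := by simpa using hy
      have := hv.weight ⟨y, hy0⟩
      simp only at this
      rw [this, hξ ⟨y, hy0⟩ ⟨hfar.1, fun i j h => hfar.2 i j (by push_cast at hn; omega)⟩, zero_smul]
    · have hmem : ρ y v ∈ comp ρ v (-k) := by
        simpa using apply_mem_comp hρ hv hy (Submodule.subset_span Monomial.vac : v ∈ comp ρ v 0)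
      refine eq_zero_of_singular hρ hirr hv (j := -k) (by omega) hmem fun q hq x hx => ?_
      have hpos : ∀ p, 0 < p → ∀ x ∈ deg p, ρ x v = 0 := fun p hp x hx =>
        hv.pos_annihilates x (Submodule.mem_iSup_of_mem (⟨p, hp⟩ : {p : ℤ // 0 < p}) hx)
      have hbr : ρ (InfSPO.hatBracket y x) v = 0 := by
        have hd := hatBracket_mem_deg hy hx
        by_cases hqk : q ≤ k
        · have hf := hfar.hatBracket hy hx (by rw [abs_neg, abs_of_nonneg] <;> omega)
          rw [abs_of_pos hq] at hf
          refine ih (k - q).toNat (by omega) _ ?_ _ ?_ hf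
          · rw [Int.toNat_of_nonneg (by omega)]; omega
          · rwa [Int.toNat_of_nonneg (by omega), show -((k : ℤ) - q) = -k + q by ring]
        · exact hpos _ (by omega) _ hd
      have := hρ.apply hy hx v
      rw [hpos q hq x hx, map_zero, hbr, zero_add] at this
      have hs : sgn (-k * q) ≠ 0 := zpow_ne_zero _ (by norm_num)
      exact (smul_eq_zero.1 this.symm).resolve_left hs

/-- Elements of degree `p` far enough from the centre annihilate a given component `M_j`. -/
theorem IsFar.apply_comp_eq_zero {ρ : CHat →ₗ[ℂ] Module.End ℂ M} (hρ : IsRep ρ)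
    (hirr : IsIrreducible ρ) {ξ : Module.Dual ℂ (deg 0)} {v : M} (hv : IsHighestWeight ρ ξ v)
    {n₀ : ℤ} (hn₀ : 0 ≤ n₀) (hξ : ∀ h : deg 0, IsFar n₀ h → ξ h = 0) {p j n : ℤ}
    (hn : n₀ + |p| - 2 * j ≤ n) {y : CHat} (hy : y ∈ deg p) (hfar : IsFar n y) {m : M}
    (hm : m ∈ comp ρ v j) : ρ y m = 0 := by
  have hmon : ∀ {j : ℤ} {m : M}, Monomial ρ v j m → ∀ {p n : ℤ} {y : CHat},
      n₀ + |p| - 2 * j ≤ n → y ∈ deg p → IsFar n y → ρ y m = 0 := by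
    intro j m hm
    induction hm with
    | vac =>
      intro p n y hn hy hfar
      rcases lt_or_ge 0 p with h | h
      · exact hv.pos_annihilates y (Submodule.mem_iSup_of_mem (⟨p, h⟩ : {p : ℤ // 0 < p}) hy)
      · rw [abs_of_nonpos h] at hn
        refine IsFar.apply_highestWeight_eq_zero hρ hirr hv hn₀ hξ (-p).toNat n ?_ y ?_ hfar
        · rw [Int.toNat_of_nonneg (by omega)]; omega
        · rwa [Int.toNat_of_nonneg (by omega), neg_neg]
    | @step q i x m hq hx hm ih =>
      intro p n y hn hy hfar
      have hi : i ≤ 0 := by have := hm.eq_or_neg; omega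
      have hp := abs_nonneg p
      rw [hρ.apply hy hx, ih (by omega) hy hfar, map_zero, smul_zero, add_zero]
      have hadd := abs_add_le p q
      have hq' := abs_of_neg hq
      exact ih (by omega) (hatBracket_mem_deg hy hx) (hfar.hatBracket hy hx (by omega))
  induction hm using Submodule.span_induction with
  | mem m hm => exact hmon hm hn hy hfar
  | zero => rw [map_zero]
  | add a b _ _ ha hb => rw [map_add, ha, hb, add_zero]
  | smul c a _ ha => rw [map_smul, ha, smul_zero]

theorem finiteDimensional_map₂ {K V W : Type*} [Field K] [AddCommGroup V] [Module K V]
    [AddCommGroup W] [Module K W] {U : Type*} [AddCommGroup U] [Module K U]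
    (f : V →ₗ[K] W →ₗ[K] U) (P : Submodule K V) (Q : Submodule K W) [hQ : FiniteDimensional K Q]
    (h : ∀ w ∈ Q, FiniteDimensional K (P.map (f.flip w))) :
    FiniteDimensional K (Submodule.map₂ f P Q) := by
  obtain ⟨S, hS, hSf⟩ := Submodule.fg_def.1 (Module.Finite.iff_fg.1 hQ)
  have hSub : S ⊆ Q := hSf ▸ Submodule.subset_span
  rw [← hSf, Submodule.span_eq_iSup_of_singleton_spans, iSup_subtype', Submodule.map₂_iSup_right]
  have := hS.to_subtype
  have (s : S) : FiniteDimensional K (Submodule.map₂ f P (Submodule.span K {(s : W)})) := by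
    rw [Submodule.map₂_span_singleton_eq_map_flip]
    exact h s (hSub s.2)
  exact Submodule.finiteDimensional_iSup _

/-- A linear map that factors on `P` through a map to a finite-dimensional space has a
finite-dimensional image on `P`. -/
theorem finiteDimensional_map_of_inf_ker_le {K V W U : Type*} [Field K] [AddCommGroup V]
    [Module K V] [AddCommGroup W] [Module K W] [AddCommGroup U] [Module K U]
    [FiniteDimensional K W] (L : V →ₗ[K] W) (f : V →ₗ[K] U) (P : Submodule K V)
    (h : ∀ x ∈ P, L x = 0 → f x = 0) : FiniteDimensional K (P.map f) := by
  have hk : (L.domRestrict P).ker ≤ (f.domRestrict P).ker := fun x hx => h x x.2 hx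
  have : FiniteDimensional K (P ⧸ (L.domRestrict P).ker) :=
    (L.domRestrict P).quotKerEquivRange.symm.finiteDimensional
  have hr : P.map f = (((L.domRestrict P).ker).liftQ _ hk).range := by
    rw [Submodule.range_liftQ, LinearMap.range_domRestrict]
  rw [hr]
  infer_instance

theorem isQuasiFinite_of_isFar {ρ : CHat →ₗ[ℂ] Module.End ℂ M} (hρ : IsRep ρ)
    (hirr : IsIrreducible ρ) {ξ : Module.Dual ℂ (deg 0)} {v : M} (hv : IsHighestWeight ρ ξ v)
    {n₀ : ℤ} (hn₀ : 0 ≤ n₀) (hξ : ∀ h : deg 0, IsFar n₀ h → ξ h = 0) : IsQuasiFinite ρ v := by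
  have hk : ∀ k : ℕ, FiniteDimensional ℂ (comp ρ v (-k)) := by
    intro k
    induction k using Nat.strong_induction_on with
    | _ k ih =>
      let Q : ℕ → Submodule ℂ M := fun l =>
        Submodule.map₂ ρ (deg (-(k - l : ℤ))) (comp ρ v (-l))
      have hle : comp ρ v (-k) ≤ Submodule.span ℂ {v} ⊔ ⨆ l : Fin k, Q l := by
        refine Submodule.span_le.2 ?_
        rintro m (hm : Monomial ρ v (-k) m)
        obtain ⟨j, hj⟩ : ∃ j, j = -(k : ℤ) := ⟨_, rfl⟩
        rw [← hj] at hm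
        cases hm with
        | vac => exact Submodule.mem_sup_left (Submodule.mem_span_singleton_self v)
        | @step p i x m hp hx hm =>
          have hi : i ≤ 0 := by have := hm.eq_or_neg; omega
          refine Submodule.mem_sup_right
            (Submodule.mem_iSup_of_mem (⟨(-i).toNat, by omega⟩ : Fin k) ?_)
          have hl : (((-i).toNat : ℕ) : ℤ) = -i := Int.toNat_of_nonneg (by omega)
          refine Submodule.apply_mem_map₂ ρ ?_ ?_
          · simp only [hl]
            rwa [show -((k : ℤ) - -i) = p by omega]
          · simp only [hl, neg_neg]
            exact Submodule.subset_span hm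
      have (l : Fin k) : FiniteDimensional ℂ (Q l) := by
        have := ih l l.2
        refine finiteDimensional_map₂ _ _ _ fun m hm => ?_
        set p := -((k : ℤ) - (l : ℕ))
        refine finiteDimensional_map_of_inf_ker_le
          (nearPart (n₀ + |p| - 2 * (-(l : ℕ))) p) _ _ fun x hx h0 => ?_
        exact IsFar.apply_comp_eq_zero hρ hirr hv hn₀ hξ le_rfl hx
          (isFar_of_nearPart_eq_zero hx h0) hm
      exact Submodule.finiteDimensional_of_le hle
  intro j
  rcases le_or_gt j 0 with h | h
  · have := hk (-j).toNat
    rwa [Int.toNat_of_nonneg (by omega), neg_neg] at this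
  · have : comp ρ v j = ⊥ := by
      refine Submodule.span_eq_bot.2 fun m hm => ?_
      have := Monomial.eq_or_neg hm
      omega
    rw [this]
    infer_instance

/-! ### Finite-dimensionality in degree `-1/2` bounds the weight -/

/-- Since `Ĉ_{-1/2} v` is finite dimensional, some sequence of values of a nonzero polynomial
annihilates `v`. Its brackets with `Ĉ_{1/2}` contain every diagonal element supported beyond its
finitely many zeros. -/
theorem exists_weight_vanishing {ρ : CHat →ₗ[ℂ] Module.End ℂ M} (hρ : IsRep ρ)
    {ξ : Module.Dual ℂ (deg 0)} {v : M} (hv : IsHighestWeight ρ ξ v)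
    (hfin : FiniteDimensional ℂ ((deg (-1)).map (ρ.flip v))) :
    ∃ N : ℕ, 0 < N ∧ ∀ x : ℤ → ℂ, (∀ i ≤ 2 * (N : ℤ), x i = 0) →
      ξ ⟨posDiag 0 x, posDiag_mem 0 x⟩ = 0 := by
  -- the factor `X - 1` makes the sequences vanish at `i = 1`
  let ev : Polynomial ℂ →ₗ[ℂ] (ℤ → ℂ) :=
    LinearMap.pi fun i : ℤ => (Polynomial.leval (i : ℂ)).comp
      (LinearMap.mulLeft ℂ (Polynomial.X - Polynomial.C 1))
  let Φ : Polynomial ℂ →ₗ[ℂ] (deg (-1)).map (ρ.flip v) :=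
    LinearMap.codRestrict _ ((ρ.flip v).comp ((posDiag (-1)).comp ev)) fun P =>
      Submodule.mem_map_of_mem (posDiag_mem (-1) _)
  have hninj : ¬ Function.Injective Φ := fun h =>
    Polynomial.not_finite (R := ℂ) (Module.Finite.of_injective Φ h)
  obtain ⟨P, hP, hP0⟩ : ∃ P, Φ P = 0 ∧ P ≠ 0 := by
    by_contra! h
    exact hninj ((injective_iff_map_eq_zero Φ).2 h)
  set a := ev P with ha
  have hav : ρ (posDiag (-1) a) v = 0 := congrArg Subtype.val hP
  have hroot : ∃ N : ℕ, 0 < N ∧ ∀ i : ℤ, 2 * (N : ℤ) < i → a i ≠ 0 := by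
    have hne : (Polynomial.X - Polynomial.C 1) * P ≠ 0 :=
      mul_ne_zero (Polynomial.X_sub_C_ne_zero 1) hP0
    have hf : {i : ℤ | a i = 0}.Finite := by
      refine ((Polynomial.finite_setOfPred_isRoot hne).preimage
        (f := fun i : ℤ => (i : ℂ)) (Int.cast_injective.injOn)).subset fun i hi => hi
    obtain ⟨b, hb⟩ := hf.bddAbove
    refine ⟨b.toNat + 1, by omega, fun i hi h => ?_⟩
    have := hb h
    push_cast at hi
    omega
  have ha1 : a 1 = 0 := by simp [ha, ev]
  obtain ⟨N, hN, hroot⟩ := hroot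
  refine ⟨N, hN, fun x hx => ?_⟩
  -- `c` solves the recursion `c (i + 1) + c i = x i`
  let c : ℤ → ℂ := fun i => -sgn i * ∑ k ∈ Finset.Ico 1 i, sgn k * x k
  have hc0 : ∀ i ≤ 2 * (N : ℤ) + 1, c i = 0 := fun i hi => by
    have : ∑ k ∈ Finset.Ico 1 i, sgn k * x k = 0 := Finset.sum_eq_zero fun k hk => by
      rw [hx k (by have := Finset.mem_Ico.1 hk; omega), mul_zero]
    simp [c, this]
  have hc : ∀ i, 0 < i → c (i + 1) + c i = x i := fun i hi => by
    have s1 : sgn (i + 1) = -sgn i := by rw [sgn_add, sgn_odd odd_one]; ring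
    have s2 : sgn i * sgn i = 1 := by rw [← sgn_add]; exact sgn_even ⟨_, rfl⟩
    have hI : Finset.Ico 1 (i + 1) = insert i (Finset.Ico 1 i) := by
      ext k; simp only [Finset.mem_Ico, Finset.mem_insert]; omega
    simp only [c]
    rw [hI, Finset.sum_insert (by simp), s1]
    linear_combination x i * s2
  have hca : ∀ i, c i / a i * a i = c i := fun i => by
    rcases le_or_gt i (2 * (N : ℤ)) with h | h
    · rw [hc0 i (by omega)]; simp
    · exact div_mul_cancel₀ _ (hroot i h)
  -- chosen so that `a i * b (i - 1) = c i`
  let b : ℤ → ℂ := fun i => c (i + 1) / a (i + 1)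
  have hbr : hatBracket (posDiag 1 b) (posDiag (-1) a) = posDiag 0 x := by
    rw [hatBracket_posDiag_one_neg_one a b ha1]
    refine deg_zero_ext (posDiag_mem 0 _) (posDiag_mem 0 _) (fun i hi => ?_) rfl
    rw [posDiag_apply_of_pos 0 _ hi hi, posDiag_apply_of_pos 0 _ hi hi, if_pos (sub_self i),
      if_pos (sub_self i)]
    simp only [b, sub_add_cancel]
    rw [hca, mul_comm, hca, hc i hi]
  have happ := hρ.apply (posDiag_mem 1 b) (posDiag_mem (-1) a) v
  rw [hav, hv.pos_annihilates _ (Submodule.mem_iSup_of_mem (⟨1, one_pos⟩ : {p : ℤ // 0 < p})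
    (posDiag_mem 1 b)), map_zero, map_zero, smul_zero, add_zero, hbr] at happ
  have hw := hv.weight ⟨posDiag 0 x, posDiag_mem 0 x⟩
  simp only at hw
  rw [← happ] at hw
  exact (smul_eq_zero.1 hw.symm).resolve_right hv.ne_zero

/-- A weight that vanishes on the diagonal elements supported beyond `2 N` is a combination of the
fundamental weights `ω_j`, `j ≤ 2 N`, and `Λ_0`. -/
theorem exists_eq_sum_omega {ξ : Module.Dual ℂ (deg 0)} {N : ℕ}
    (h : ∀ x : ℤ → ℂ, (∀ i ≤ 2 * (N : ℤ), x i = 0) → ξ ⟨posDiag 0 x, posDiag_mem 0 x⟩ = 0) :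
    ∃ (c : ℤ → ℂ) (d : ℂ),
      ξ = (∑ j ∈ Finset.Icc (1 : ℤ) (2 * N), c j • omega j) + d • Lambda0 := by
  let δ : ℤ → deg 0 := fun j => ⟨posDiag 0 (Pi.single j 1), posDiag_mem 0 _⟩
  let C : deg 0 := ⟨(0, 1), fun _ _ _ => rfl, fun h => absurd rfl h⟩
  refine ⟨fun j => ξ (δ j), ξ C, LinearMap.ext fun t => ?_⟩
  let x : ℤ → ℂ := fun i => if i ≤ 2 * (N : ℤ) then 0 else (t.1.1 : Matrix ℤ ℤ ℂ) i i
  let X : deg 0 := ⟨posDiag 0 x, posDiag_mem 0 x⟩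
  have hX : ξ X = 0 := h x fun i hi => if_pos hi
  have ht : t = (∑ j ∈ Finset.Icc (1 : ℤ) (2 * N), omega j t • δ j) + Lambda0 t • C + X := by
    refine Subtype.ext (deg_zero_ext t.2 (Subtype.property _) (fun i hi => ?_) ?_)
    · have e : ∀ u : deg 0, (u.1.1 : Matrix ℤ ℤ ℂ) i i = omega i u := fun _ => rfl
      have hδ : ∀ j, omega i (δ j) = if i = j then 1 else 0 := fun j => by
        rw [← e, posDiag_apply_of_pos 0 _ hi hi, if_pos (sub_self i), Pi.single_apply]
      have hC : omega i C = 0 := rfl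
      have hXi : omega i X = x i := by
        rw [← e, posDiag_apply_of_pos 0 _ hi hi, if_pos (sub_self i)]
      rw [e, e]
      simp only [map_add, map_sum, map_smul, hδ, hC, hXi, smul_eq_mul, mul_ite, mul_one, mul_zero,
        Finset.sum_ite_eq, Finset.mem_Icc, x, add_zero]
      by_cases hiN : i ≤ 2 * (N : ℤ)
      · rw [if_pos ⟨by omega, hiN⟩, if_pos hiN, add_zero]
      · rw [if_neg (by omega), if_neg hiN, zero_add]
        rfl
    · have e : ∀ u : deg 0, u.1.2 = Lambda0 u := fun _ => rfl
      have hδ : ∀ j, Lambda0 (δ j) = 0 := fun j => rfl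
      have hC : Lambda0 C = 1 := rfl
      have hXi : Lambda0 X = 0 := rfl
      rw [e, e]
      simp [hδ, hC, hXi]
  conv_lhs => rw [ht]
  simp only [map_add, map_sum, map_smul, hX, add_zero, LinearMap.add_apply, LinearMap.sum_apply,
    LinearMap.smul_apply, smul_eq_mul, mul_comm]

theorem sum_omega_eq_zero_of_isFar {N : ℕ} (c : ℤ → ℂ) (d : ℂ) (h : deg 0)
    (hfar : IsFar (2 * N) h) :
    ((∑ j ∈ Finset.Icc (1 : ℤ) (2 * N), c j • omega j) + d • Lambda0) h = 0 := by
  have h1 : Lambda0 h = 0 := hfar.1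
  have h2 : ∀ j ∈ Finset.Icc (1 : ℤ) (2 * N), omega j h = 0 := fun j hj => by
    rw [Finset.mem_Icc] at hj
    exact hfar.2 j j (Or.inl (by rw [abs_of_nonneg] <;> omega))
  simp only [LinearMap.add_apply, LinearMap.sum_apply, LinearMap.smul_apply, h1, smul_zero,
    add_zero]
  exact Finset.sum_eq_zero fun j hj => by rw [h2 j hj, smul_zero]

end InfSPO

theorem mainTheorem8 {M : Type*} [AddCommGroup M] [Module ℂ M]
    (ρ : InfSPO.CHat →ₗ[ℂ] Module.End ℂ M) (hρ : InfSPO.IsRep ρ)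
    (hirr : InfSPO.IsIrreducible ρ)
    (ξ : Module.Dual ℂ (InfSPO.deg 0)) (v : M) (hv : InfSPO.IsHighestWeight ρ ξ v) :
    List.TFAE [
      InfSPO.IsQuasiFinite ρ v,
      FiniteDimensional ℂ ((InfSPO.deg (-1)).map (ρ.flip v)),
      ∃ N : ℕ, 0 < N ∧ ∃ (c : ℤ → ℂ) (d : ℂ),
        ξ = (∑ j ∈ Finset.Icc (1 : ℤ) (2 * N), c j • InfSPO.omega j) + d • InfSPO.Lambda0] := by
  tfae_have 1 → 2 := fun h => by
    have := h (-1)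
    refine Submodule.finiteDimensional_of_le (S₂ := InfSPO.comp ρ v (-1)) ?_
    rintro _ ⟨x, hx, rfl⟩
    simpa using InfSPO.apply_mem_comp hρ hv hx
      (Submodule.subset_span InfSPO.Monomial.vac : v ∈ InfSPO.comp ρ v 0)
  tfae_have 2 → 3 := fun h => by
    obtain ⟨N, hN, hξ⟩ := InfSPO.exists_weight_vanishing hρ hv h
    exact ⟨N, hN, InfSPO.exists_eq_sum_omega hξ⟩
  tfae_have 3 → 1 := by
    rintro ⟨N, -, c, d, rfl⟩
    exact InfSPO.isQuasiFinite_of_isFar hρ hirr hv (n₀ := 2 * N) (by omega)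
      (InfSPO.sum_omega_eq_zero_of_isFar c d)
  tfae_finish
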